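/- Rings are associative and not necessarily unital. A nonzero ring $R$ is prime if $aRb=0$ with $a,b\in R$ implies $a=0$ or $b=0$. For a prime ring $R$, let $Q_s(R)\supseteq R$ be its Martindale symmetric ring of quotients and let $C$, the center of $Q_s(R)$, be its extended centroid (a field). For a subset $A\subseteq R$ let $AC$ be the additive subgroup of $Q_s(R)$ generated by all $ac$ with $a\in A$, $c\in C$. A Lie ideal of $R$ is an additive subgroup $K$ with $ar-ra\in K$ for all $a\in K$, $r\in R$; it is noncentral if it is not contained in the center $Z(R)$. The product $K_1\cdots K_m$ is the additive subgroup of $R$ generated by all products $a_1\cdots a_m$ with $a_i\in K_i$. **Theorem.** Let $R$ be a prime ring with noncentral Lie ideals $K_1,\ldots,K_m$, where $m\ge 1$. Then one of the following two cases holds: - the centralizer of $K_1\cdots K_m$ in $R$ is $Z(R)$, that is, $\{x\in R: ax=xa\ \text{for all}\ a\in K_1\cdots K_m\}=Z(R)$; or - $K_jC=K_1C$ for $j=1,\ldots,m$, $\dim_C K_1C=2$, and the centralizer of $K_1\cdots K_m$ in $RC$ is $K_1C$, that is, $\{x\in RC: ax=xa\ \text{for all}\ a\in K_1\cdots K_m\}=K_1C$.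 -/

import Mathlib

/-! ### Prime rings -/

/-- A (not necessarily unital) associative ring `R` is prime if it is nonzero and
`a R b = 0` implies `a = 0` or `b = 0`. -/
class IsPrimeRing (R : Type*) [NonUnitalRing R] : Prop extends Nontrivial R where
  eq_zero_or_eq_zero : ∀ a b : R, (∀ r : R, a * r * b = 0) → a = 0 ∨ b = 0

namespace Martindale

variable {R : Type*} [NonUnitalRing R]

/-- The product `J I` of two ideals: the additive subgroup generated by all products. -/
def mulIdeal (J I : TwoSidedIdeal R) : TwoSidedIdeal R :=
  TwoSidedIdeal.mk' (AddSubgroup.closure {z : R | ∃ x ∈ J, ∃ y ∈ I, z = x * y} : AddSubgroup R)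
    (zero_mem _) (fun hx hy => add_mem hx hy) (fun hx => neg_mem hx)
    (by
      intro r z hz
      simp only [SetLike.mem_coe] at hz ⊢
      induction hz using AddSubgroup.closure_induction with
      | mem z hz =>
        obtain ⟨x, hx, y, hy, rfl⟩ := hz
        exact AddSubgroup.subset_closure
          ⟨r * x, J.mul_mem_left _ _ hx, y, hy, (mul_assoc _ _ _).symm⟩
      | zero => simp
      | add a b _ _ ha hb => rw [mul_add]; exact add_mem ha hb
      | neg a _ ha => rw [mul_neg]; exact neg_mem ha)
    (by
      intro z r hz
      simp only [SetLike.mem_coe] at hz ⊢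
      induction hz using AddSubgroup.closure_induction with
      | mem z hz =>
        obtain ⟨x, hx, y, hy, rfl⟩ := hz
        exact AddSubgroup.subset_closure
          ⟨x, hx, y * r, I.mul_mem_right _ _ hy, mul_assoc _ _ _⟩
      | zero => simp
      | add a b _ _ ha hb => rw [add_mul]; exact add_mem ha hb
      | neg a _ ha => rw [neg_mul]; exact neg_mem ha)

theorem mul_mem_mulIdeal {J I : TwoSidedIdeal R} {x y : R} (hx : x ∈ J) (hy : y ∈ I) :
    x * y ∈ mulIdeal J I :=
  (TwoSidedIdeal.mem_mk' _ _ _ _ _ _ _).2 (AddSubgroup.subset_closure ⟨x, hx, y, hy, rfl⟩)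

theorem mulIdeal_induction {J I : TwoSidedIdeal R} {p : R → Prop}
    (mul : ∀ x ∈ J, ∀ y ∈ I, p (x * y)) (zero : p 0)
    (add : ∀ x ∈ mulIdeal J I, ∀ y ∈ mulIdeal J I, p x → p y → p (x + y))
    (neg : ∀ x ∈ mulIdeal J I, p x → p (-x)) {z : R} (hz : z ∈ mulIdeal J I) : p z := by
  have hz' := (TwoSidedIdeal.mem_mk' _ _ _ _ _ _ _).1 hz
  simp only [SetLike.mem_coe] at hz'
  clear hz
  induction hz' using AddSubgroup.closure_induction with
  | mem z hz => obtain ⟨x, hx, y, hy, rfl⟩ := hz; exact mul x hx y hy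
  | zero => exact zero
  | add a b ha hb iha ihb =>
    exact add a ((TwoSidedIdeal.mem_mk' _ _ _ _ _ _ _).2 ha) b
      ((TwoSidedIdeal.mem_mk' _ _ _ _ _ _ _).2 hb) iha ihb
  | neg a ha iha => exact neg a ((TwoSidedIdeal.mem_mk' _ _ _ _ _ _ _).2 ha) iha

theorem mulIdeal_le_left (J I : TwoSidedIdeal R) : mulIdeal J I ≤ J := fun _ hz =>
  mulIdeal_induction (p := (· ∈ J)) (fun _ hx _ _ => J.mul_mem_right _ _ hx) J.zero_mem
    (fun _ _ _ _ => J.add_mem) (fun _ _ => J.neg_mem) hz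

theorem mulIdeal_le_right (J I : TwoSidedIdeal R) : mulIdeal J I ≤ I := fun _ hz =>
  mulIdeal_induction (p := (· ∈ I)) (fun _ _ _ hy => I.mul_mem_left _ _ hy) I.zero_mem
    (fun _ _ _ _ => I.add_mem) (fun _ _ => I.neg_mem) hz

theorem mulIdeal_mono {J J' I I' : TwoSidedIdeal R} (hJ : J ≤ J') (hI : I ≤ I') :
    mulIdeal J I ≤ mulIdeal J' I' := fun _ hz =>
  mulIdeal_induction (p := (· ∈ mulIdeal J' I'))
    (fun _ hx _ hy => mul_mem_mulIdeal (hJ hx) (hI hy)) (TwoSidedIdeal.zero_mem _)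
    (fun _ _ _ _ => TwoSidedIdeal.add_mem _) (fun _ _ => TwoSidedIdeal.neg_mem _) hz

theorem exists_mem_ne_zero {I : TwoSidedIdeal R} (hI : I ≠ ⊥) : ∃ x ∈ I, x ≠ 0 := by
  by_contra! h
  exact hI (le_antisymm (fun x hx => (TwoSidedIdeal.mem_bot R).2 (h x hx)) bot_le)

/-! ### The symmetric Martindale ring of quotients -/

/-- A partially defined symmetric multiplier of `R`: a nonzero ideal `dom`, a right `R`-module
homomorphism `l : dom → R` and a left `R`-module homomorphism `r : dom → R` with
`x (l y) = (r x) y` on `dom`. It stands for the element `q` with `q x = l x` and `x q = r x` for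
`x ∈ dom`. The maps are written as total functions whose values outside `dom` are irrelevant
(they are forgotten by `SymMul.setoid`). -/
structure SymMul (R : Type*) [NonUnitalRing R] where
  dom : TwoSidedIdeal R
  dom_ne : dom ≠ ⊥
  l : R → R
  r : R → R
  l_add : ∀ x ∈ dom, ∀ y ∈ dom, l (x + y) = l x + l y
  r_add : ∀ x ∈ dom, ∀ y ∈ dom, r (x + y) = r x + r y
  l_mul : ∀ x ∈ dom, ∀ a : R, l (x * a) = l x * a
  r_mul : ∀ x ∈ dom, ∀ a : R, r (a * x) = a * r x
  balanced : ∀ x ∈ dom, ∀ y ∈ dom, x * l y = r x * y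

namespace SymMul

theorem l_zero (q : SymMul R) : q.l 0 = 0 := by
  simpa using q.l_add 0 q.dom.zero_mem 0 q.dom.zero_mem

theorem r_zero (q : SymMul R) : q.r 0 = 0 := by
  simpa using q.r_add 0 q.dom.zero_mem 0 q.dom.zero_mem

theorem l_neg (q : SymMul R) {x : R} (hx : x ∈ q.dom) : q.l (-x) = -q.l x := by
  have h := q.l_add x hx (-x) (q.dom.neg_mem hx)
  rw [add_neg_cancel, l_zero] at h
  exact (neg_eq_of_add_eq_zero_right h.symm).symm

theorem r_neg (q : SymMul R) {x : R} (hx : x ∈ q.dom) : q.r (-x) = -q.r x := by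
  have h := q.r_add x hx (-x) (q.dom.neg_mem hx)
  rw [add_neg_cancel, r_zero] at h
  exact (neg_eq_of_add_eq_zero_right h.symm).symm

theorem l_mem (q : SymMul R) {J I : TwoSidedIdeal R} (hJ : J ≤ q.dom) {x : R}
    (hx : x ∈ mulIdeal J I) : q.l x ∈ I := by
  have hd : mulIdeal J I ≤ q.dom := (mulIdeal_le_left J I).trans hJ
  refine mulIdeal_induction (p := fun x => q.l x ∈ I) ?_ ?_ ?_ ?_ hx
  · intro x hx y hy
    rw [q.l_mul x (hJ hx)]
    exact I.mul_mem_left _ _ hy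
  · rw [q.l_zero]; exact I.zero_mem
  · intro x hx y hy h1 h2
    rw [q.l_add x (hd hx) y (hd hy)]
    exact I.add_mem h1 h2
  · intro x hx h1
    rw [q.l_neg (hd hx)]
    exact I.neg_mem h1

theorem r_mem (q : SymMul R) {J I : TwoSidedIdeal R} (hI : I ≤ q.dom) {x : R}
    (hx : x ∈ mulIdeal J I) : q.r x ∈ J := by
  have hd : mulIdeal J I ≤ q.dom := (mulIdeal_le_right J I).trans hI
  refine mulIdeal_induction (p := fun x => q.r x ∈ J) ?_ ?_ ?_ ?_ hx
  · intro x hx y hy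
    rw [q.r_mul y (hI hy)]
    exact J.mul_mem_right _ _ hx
  · rw [q.r_zero]; exact J.zero_mem
  · intro x hx y hy h1 h2
    rw [q.r_add x (hd hx) y (hd hy)]
    exact J.add_mem h1 h2
  · intro x hx h1
    rw [q.r_neg (hd hx)]
    exact J.neg_mem h1

/-- Two partial multipliers are identified if they agree on some nonzero ideal contained in both
domains. -/
def Rel (p q : SymMul R) : Prop :=
  ∃ K : TwoSidedIdeal R, K ≠ ⊥ ∧ K ≤ p.dom ∧ K ≤ q.dom ∧
    ∀ x ∈ K, p.l x = q.l x ∧ p.r x = q.r x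

/-- The negative of a partial multiplier. -/
def neg (p : SymMul R) : SymMul R where
  dom := p.dom
  dom_ne := p.dom_ne
  l x := -p.l x
  r x := -p.r x
  l_add x hx y hy := by rw [p.l_add x hx y hy, neg_add]
  r_add x hx y hy := by rw [p.r_add x hx y hy, neg_add]
  l_mul x hx a := by rw [p.l_mul x hx, neg_mul]
  r_mul x hx a := by rw [p.r_mul x hx, mul_neg]
  balanced x hx y hy := by rw [mul_neg, neg_mul, p.balanced x hx y hy]

theorem neg_congr {p p' : SymMul R} (hp : Rel p p') : Rel (neg p) (neg p') := by
  obtain ⟨K, h0, h1, h2, h⟩ := hp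
  exact ⟨K, h0, h1, h2, fun x hx => ⟨congrArg Neg.neg (h x hx).1, congrArg Neg.neg (h x hx).2⟩⟩

end SymMul

variable [IsPrimeRing R]

theorem mulIdeal_ne_bot {J I : TwoSidedIdeal R} (hJ : J ≠ ⊥) (hI : I ≠ ⊥) :
    mulIdeal J I ≠ ⊥ := by
  intro h
  obtain ⟨a, ha, ha0⟩ := exists_mem_ne_zero hJ
  obtain ⟨b, hb, hb0⟩ := exists_mem_ne_zero hI
  rcases IsPrimeRing.eq_zero_or_eq_zero a b (fun r =>
    (TwoSidedIdeal.mem_bot R).1 (h ▸ mul_mem_mulIdeal (J.mul_mem_right a r ha) hb)) with h | h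
  exacts [ha0 h, hb0 h]

theorem inf_ne_bot {J I : TwoSidedIdeal R} (hJ : J ≠ ⊥) (hI : I ≠ ⊥) : J ⊓ I ≠ ⊥ := fun h =>
  mulIdeal_ne_bot hJ hI
    (le_bot_iff.1 (h ▸ le_inf (mulIdeal_le_left J I) (mulIdeal_le_right J I)))

theorem top_ne_bot' : (⊤ : TwoSidedIdeal R) ≠ ⊥ := by
  intro h
  obtain ⟨x, hx⟩ := exists_ne (0 : R)
  exact hx ((TwoSidedIdeal.mem_bot R).1 (h ▸ (TwoSidedIdeal.mem_top R : x ∈ ⊤)))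

namespace SymMul

variable (R) in
instance setoid : Setoid (SymMul R) where
  r := Rel
  iseqv :=
    { refl := fun p => ⟨p.dom, p.dom_ne, le_rfl, le_rfl, fun _ _ => ⟨rfl, rfl⟩⟩
      symm := fun ⟨K, h0, h1, h2, h⟩ =>
        ⟨K, h0, h2, h1, fun x hx => ⟨(h x hx).1.symm, (h x hx).2.symm⟩⟩
      trans := fun ⟨K, h0, h1, _, h⟩ ⟨K', h0', _, h2', h'⟩ =>
        ⟨K ⊓ K', inf_ne_bot h0 h0', inf_le_left.trans h1, inf_le_right.trans h2', fun x hx =>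
          have hx' := (TwoSidedIdeal.mem_inf R).1 hx
          ⟨(h x hx'.1).1.trans (h' x hx'.2).1, (h x hx'.1).2.trans (h' x hx'.2).2⟩⟩ }

/-- Left and right multiplication by an element of `R`. -/
def ofRing (a : R) : SymMul R where
  dom := ⊤
  dom_ne := top_ne_bot'
  l x := a * x
  r x := x * a
  l_add _ _ _ _ := mul_add _ _ _
  r_add _ _ _ _ := add_mul _ _ _
  l_mul _ _ _ := (mul_assoc _ _ _).symm
  r_mul _ _ _ := mul_assoc _ _ _
  balanced _ _ _ _ := (mul_assoc _ _ _).symm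

/-- The identity multiplier. -/
def one : SymMul R where
  dom := ⊤
  dom_ne := top_ne_bot'
  l x := x
  r x := x
  l_add _ _ _ _ := rfl
  r_add _ _ _ _ := rfl
  l_mul _ _ _ := rfl
  r_mul _ _ _ := rfl
  balanced _ _ _ _ := rfl

/-- The sum of two partial multipliers. -/
def add (p q : SymMul R) : SymMul R where
  dom := p.dom ⊓ q.dom
  dom_ne := inf_ne_bot p.dom_ne q.dom_ne
  l x := p.l x + q.l x
  r x := p.r x + q.r x
  l_add x hx y hy := by
    have hx := (TwoSidedIdeal.mem_inf R).1 hx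
    have hy := (TwoSidedIdeal.mem_inf R).1 hy
    rw [p.l_add x hx.1 y hy.1, q.l_add x hx.2 y hy.2, add_add_add_comm]
  r_add x hx y hy := by
    have hx := (TwoSidedIdeal.mem_inf R).1 hx
    have hy := (TwoSidedIdeal.mem_inf R).1 hy
    rw [p.r_add x hx.1 y hy.1, q.r_add x hx.2 y hy.2, add_add_add_comm]
  l_mul x hx a := by
    have hx := (TwoSidedIdeal.mem_inf R).1 hx
    rw [p.l_mul x hx.1, q.l_mul x hx.2, add_mul]
  r_mul x hx a := by
    have hx := (TwoSidedIdeal.mem_inf R).1 hx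
    rw [p.r_mul x hx.1, q.r_mul x hx.2, mul_add]
  balanced x hx y hy := by
    have hx := (TwoSidedIdeal.mem_inf R).1 hx
    have hy := (TwoSidedIdeal.mem_inf R).1 hy
    rw [mul_add, add_mul, p.balanced x hx.1 y hy.1, q.balanced x hx.2 y hy.2]

/-- The product of two partial multipliers: `(p q) x = p (q x)` and `x (p q) = (x p) q`. -/
def mul (p q : SymMul R) : SymMul R where
  dom := mulIdeal q.dom p.dom
  dom_ne := mulIdeal_ne_bot q.dom_ne p.dom_ne
  l x := p.l (q.l x)
  r x := q.r (p.r x)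
  l_add x hx y hy := by
    rw [q.l_add x (mulIdeal_le_left _ _ hx) y (mulIdeal_le_left _ _ hy),
      p.l_add _ (q.l_mem le_rfl hx) _ (q.l_mem le_rfl hy)]
  r_add x hx y hy := by
    rw [p.r_add x (mulIdeal_le_right _ _ hx) y (mulIdeal_le_right _ _ hy),
      q.r_add _ (p.r_mem le_rfl hx) _ (p.r_mem le_rfl hy)]
  l_mul x hx a := by
    rw [q.l_mul x (mulIdeal_le_left _ _ hx), p.l_mul _ (q.l_mem le_rfl hx)]
  r_mul x hx a := by
    rw [p.r_mul x (mulIdeal_le_right _ _ hx), q.r_mul _ (p.r_mem le_rfl hx)]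
  balanced x hx y hy := by
    rw [p.balanced x (mulIdeal_le_right _ _ hx) _ (q.l_mem le_rfl hy),
      q.balanced _ (p.r_mem le_rfl hx) y (mulIdeal_le_left _ _ hy)]

theorem add_congr {p p' q q' : SymMul R} (hp : Rel p p') (hq : Rel q q') :
    Rel (add p q) (add p' q') := by
  obtain ⟨K, h0, h1, h2, h⟩ := hp
  obtain ⟨K', h0', h1', h2', h'⟩ := hq
  refine ⟨K ⊓ K', inf_ne_bot h0 h0', inf_le_inf h1 h1', inf_le_inf h2 h2', fun x hx => ?_⟩
  have hx := (TwoSidedIdeal.mem_inf R).1 hx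
  exact ⟨congrArg₂ (· + ·) (h x hx.1).1 (h' x hx.2).1,
    congrArg₂ (· + ·) (h x hx.1).2 (h' x hx.2).2⟩

theorem mul_congr {p p' q q' : SymMul R} (hp : Rel p p') (hq : Rel q q') :
    Rel (mul p q) (mul p' q') := by
  obtain ⟨K, h0, h1, h2, h⟩ := hp
  obtain ⟨K', h0', h1', h2', h'⟩ := hq
  refine ⟨mulIdeal K' K, mulIdeal_ne_bot h0' h0, mulIdeal_mono h1' h1, mulIdeal_mono h2' h2,
    fun x hx => ⟨?_, ?_⟩⟩
  · change p.l (q.l x) = p'.l (q'.l x)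
    rw [(h _ (q.l_mem h1' hx)).1, (h' x (mulIdeal_le_left _ _ hx)).1]
  · change q.r (p.r x) = q'.r (p'.r x)
    rw [(h' _ (p.r_mem h1 hx)).2, (h x (mulIdeal_le_right _ _ hx)).2]

/-- Multipliers that agree on both domains are identified. -/
theorem rel_of_forall {p q : SymMul R}
    (h : ∀ x ∈ p.dom, x ∈ q.dom → p.l x = q.l x ∧ p.r x = q.r x) : Rel p q :=
  ⟨p.dom ⊓ q.dom, inf_ne_bot p.dom_ne q.dom_ne, inf_le_left, inf_le_right, fun x hx =>
    h x ((TwoSidedIdeal.mem_inf R).1 hx).1 ((TwoSidedIdeal.mem_inf R).1 hx).2⟩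

end SymMul

variable (R) in
/-- The symmetric Martindale ring of quotients `Q_s(R)` of a prime ring `R`. -/
def Qs : Type _ := Quotient (SymMul.setoid R)

namespace Qs

/-- The class of a partial multiplier. -/
def mk (p : SymMul R) : Qs R := Quotient.mk (SymMul.setoid R) p

instance : Zero (Qs R) := ⟨mk (SymMul.ofRing 0)⟩

instance : One (Qs R) := ⟨mk SymMul.one⟩

instance : Add (Qs R) := ⟨Quotient.map₂ SymMul.add fun _ _ hp _ _ hq => SymMul.add_congr hp hq⟩

instance : Neg (Qs R) := ⟨Quotient.map SymMul.neg fun _ _ hp => SymMul.neg_congr hp⟩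

instance : Mul (Qs R) := ⟨Quotient.map₂ SymMul.mul fun _ _ hp _ _ hq => SymMul.mul_congr hp hq⟩

theorem mk_eq {p q : SymMul R}
    (h : ∀ x ∈ p.dom, x ∈ q.dom → p.l x = q.l x ∧ p.r x = q.r x) : mk p = mk q :=
  Quotient.sound (SymMul.rel_of_forall h)

instance : Ring (Qs R) where
  add_assoc := by
    rintro ⟨p⟩ ⟨q⟩ ⟨s⟩
    exact mk_eq fun x _ _ => ⟨add_assoc _ _ _, add_assoc _ _ _⟩
  zero_add := by
    rintro ⟨p⟩
    refine mk_eq fun x _ _ => ⟨?_, ?_⟩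
    · change 0 * x + p.l x = p.l x
      rw [zero_mul, zero_add]
    · change x * 0 + p.r x = p.r x
      rw [mul_zero, zero_add]
  add_zero := by
    rintro ⟨p⟩
    refine mk_eq fun x _ _ => ⟨?_, ?_⟩
    · change p.l x + 0 * x = p.l x
      rw [zero_mul, add_zero]
    · change p.r x + x * 0 = p.r x
      rw [mul_zero, add_zero]
  add_comm := by
    rintro ⟨p⟩ ⟨q⟩
    exact mk_eq fun x _ _ => ⟨add_comm _ _, add_comm _ _⟩
  neg_add_cancel := by
    rintro ⟨p⟩
    refine mk_eq fun x _ _ => ⟨?_, ?_⟩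
    · change -p.l x + p.l x = 0 * x
      rw [zero_mul, neg_add_cancel]
    · change -p.r x + p.r x = x * 0
      rw [mul_zero, neg_add_cancel]
  mul_assoc := by
    rintro ⟨p⟩ ⟨q⟩ ⟨s⟩
    exact mk_eq fun x _ _ => ⟨rfl, rfl⟩
  one_mul := by
    rintro ⟨p⟩
    exact mk_eq fun x _ _ => ⟨rfl, rfl⟩
  mul_one := by
    rintro ⟨p⟩
    exact mk_eq fun x _ _ => ⟨rfl, rfl⟩
  zero_mul := by
    rintro ⟨p⟩
    refine mk_eq fun x hx _ => ⟨?_, ?_⟩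
    · change 0 * p.l x = 0 * x
      rw [zero_mul, zero_mul]
    · change p.r (x * 0) = x * 0
      rw [mul_zero, p.r_zero]
  mul_zero := by
    rintro ⟨p⟩
    refine mk_eq fun x hx _ => ⟨?_, ?_⟩
    · change p.l (0 * x) = 0 * x
      rw [zero_mul, p.l_zero]
    · change p.r x * 0 = x * 0
      rw [mul_zero, mul_zero]
  left_distrib := by
    rintro ⟨p⟩ ⟨q⟩ ⟨s⟩
    refine mk_eq fun x h1 h2 => ⟨?_, rfl⟩
    have h2 := (TwoSidedIdeal.mem_inf R).1 h2
    exact p.l_add _ (q.l_mem le_rfl h2.1) _ (s.l_mem le_rfl h2.2)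
  right_distrib := by
    rintro ⟨p⟩ ⟨q⟩ ⟨s⟩
    refine mk_eq fun x h1 h2 => ⟨rfl, ?_⟩
    have h2 := (TwoSidedIdeal.mem_inf R).1 h2
    exact s.r_add _ (p.r_mem le_rfl h2.1) _ (q.r_mem le_rfl h2.2)
  nsmul := nsmulRec
  zsmul := zsmulRec

variable (R) in
/-- The canonical embedding of `R` into `Q_s(R)`. -/
def ofRing : R →ₙ+* Qs R where
  toFun a := mk (SymMul.ofRing a)
  map_zero' := rfl
  map_add' _ _ := mk_eq fun _ _ _ => ⟨add_mul _ _ _, mul_add _ _ _⟩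
  map_mul' _ _ := mk_eq fun _ _ _ => ⟨mul_assoc _ _ _, (mul_assoc _ _ _).symm⟩

end Qs

variable (R) in
/-- The extended centroid `C` of `R`: the center of `Q_s(R)`. -/
abbrev extendedCentroid : Subring (Qs R) := Subring.center (Qs R)

/-- `A C`: the additive subgroup of `Q_s(R)` generated by all products `a c` with `a ∈ A`,
`c ∈ C`, that is, the `C`-subspace of `Q_s(R)` spanned by `A`. -/
def extend (A : Set R) : Submodule (extendedCentroid R) (Qs R) :=
  Submodule.span (extendedCentroid R) (Qs.ofRing R '' A)

variable (R) in
/-- The central closure `R C`. -/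
def centralClosure : Submodule (extendedCentroid R) (Qs R) := extend (Set.univ : Set R)

end Martindale

/-! ### Lie ideals and their products -/

/-- An additive subgroup `L` of `R` is a Lie ideal if `[L, R] ⊆ L`. -/
def IsLieIdeal {R : Type*} [NonUnitalRing R] (L : AddSubgroup R) : Prop :=
  ∀ a ∈ L, ∀ r : R, a * r - r * a ∈ L

open scoped Pointwise in
/-- The product `K₀ K₁ ⋯ K_m` of `m + 1` additive subgroups, where `A B` is the additive subgroup
generated by all `a b` with `a ∈ A`, `b ∈ B`. -/
def prodSubgroups {R : Type*} [NonUnitalRing R] :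
    (m : ℕ) → (Fin (m + 1) → AddSubgroup R) → AddSubgroup R
  | 0, K => K 0
  | m + 1, K => prodSubgroups m (fun i => K i.castSucc) * K (Fin.last (m + 1))

/-!
Let `x` be a noncentral element of `Q_s(R)` centralizing a noncentral Lie ideal `K`. For `k ∈ K` the
inner derivations of `k` and `x` compose to zero on `R`; by Martindale's lemma on identities
`a r b = c r d` this forces characteristic two, `x ^ 2 ∈ C` and `k ∈ C + C x`, and then
`K C = C + C x`. In particular `1 ∈ K C`.

Suppose now that `x` centralizes `P = A B`, again a noncentral Lie ideal. If a noncentral `p ∈ P`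
centralizes `A`, then so does `x`, so `1 ∈ A C` and `x` centralizes `B`. Otherwise some
`u = [a, p] ∈ A ∩ P` is nonzero, and `u B ⊆ P C = C + C x` with `u ^ 2 ∈ C` makes `u`, and then `x`,
centralize `B`. Hence `1 ∈ B C` and `x` centralizes `A` as well. By induction a noncentral element
centralizing `K₁ ⋯ K_m` centralizes every `K_j`, so that all `K_j C` are equal to `C + C x`.
-/

open scoped Pointwise

/-- A noncentral Lie ideal: a Lie ideal which is not contained in the center of the ring. -/
structure IsNoncentralLieIdeal {R : Type*} [NonUnitalRing R] (K : AddSubgroup R) : Prop where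
  isLieIdeal : IsLieIdeal K
  not_subset_center : ¬ (K : Set R) ⊆ Set.center R

theorem mul_mem_addSubgroup_mul {R : Type*} [NonUnitalNonAssocRing R] {A B : AddSubgroup R}
    {a b : R} (ha : a ∈ A) (hb : b ∈ B) : a * b ∈ A * B :=
  AddSubmonoid.mul_mem_mul (M := A.toAddSubmonoid) (N := B.toAddSubmonoid) ha hb

theorem IsLieIdeal.mul {R : Type*} [NonUnitalRing R] {A B : AddSubgroup R} (hA : IsLieIdeal A)
    (hB : IsLieIdeal B) : IsLieIdeal (A * B) := by
  intro p hp r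
  refine AddSubmonoid.mul_induction_on (C := fun p => p * r - r * p ∈ A * B) hp
    (fun a ha b hb => ?_) fun p q hp hq => ?_
  · have leibniz : a * b * r - r * (a * b) = a * (b * r - r * b) + (a * r - r * a) * b := by
      noncomm_ring
    rw [leibniz]
    exact add_mem (mul_mem_addSubgroup_mul ha (hB b hb r))
      (mul_mem_addSubgroup_mul (hA a ha r) hb)
  · rw [add_mul, mul_add, add_sub_add_comm]
    exact add_mem hp hq

theorem lie_mul_lie_eq_neg {S A : Type*} [Mul S] [NonUnitalRing A] (φ : S →ₙ* A) {a x : A}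
    (h : ∀ r, ⁅a, ⁅x, φ r⁆⁆ = 0) (r s : S) :
    ⁅a, φ r⁆ * ⁅x, φ s⁆ = -(⁅x, φ r⁆ * ⁅a, φ s⁆) := by
  have leibniz : ⁅a, ⁅x, φ (r * s)⁆⁆ = ⁅a, ⁅x, φ r⁆⁆ * φ s + φ r * ⁅a, ⁅x, φ s⁆⁆ +
      (⁅a, φ r⁆ * ⁅x, φ s⁆ + ⁅x, φ r⁆ * ⁅a, φ s⁆) := by
    simp only [map_mul, Ring.lie_def]; noncomm_ring
  rw [h, h, h, zero_mul, mul_zero, zero_add, zero_add] at leibniz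
  exact eq_neg_of_add_eq_zero_left leibniz.symm

theorem lie_mul_mul_lie_eq_neg {S A : Type*} [Mul S] [NonUnitalRing A] (φ : S →ₙ* A) {a x : A}
    (h : ∀ r, ⁅a, ⁅x, φ r⁆⁆ = 0) (r t s : S) :
    ⁅a, φ r⁆ * φ t * ⁅x, φ s⁆ = -(⁅x, φ r⁆ * φ t * ⁅a, φ s⁆) := by
  have lie_mul (b : A) : ⁅b, φ (r * t)⁆ = ⁅b, φ r⁆ * φ t + φ r * ⁅b, φ t⁆ := by
    simp only [map_mul, Ring.lie_def]; noncomm_ring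
  have h_rt := lie_mul_lie_eq_neg φ h (r * t) s
  rw [lie_mul, lie_mul, add_mul, add_mul, mul_assoc (φ r), lie_mul_lie_eq_neg φ h t s, neg_add,
    mul_neg, mul_assoc (φ r)] at h_rt
  exact add_right_cancel h_rt

theorem commute_map_of_mem_span {𝕜 A M : Type*} [CommSemiring 𝕜] [Semiring A] [Algebra 𝕜 A]
    [AddCommMonoid M] [Module 𝕜 M] (f : M →ₗ[𝕜] A) {S : Set M} {y : A}
    (h : ∀ s ∈ S, Commute y (f s)) {q : M} (hq : q ∈ Submodule.span 𝕜 S) : Commute y (f q) := by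
  induction hq using Submodule.span_induction with
  | mem s hs => exact h s hs
  | zero => simp
  | add p q _ _ hp hq => rw [map_add]; exact hp.add_right hq
  | smul c q _ hq => rw [map_smul]; exact hq.smul_right c

theorem commute_of_mem_span_one_pair {𝕜 A : Type*} [CommSemiring 𝕜] [Semiring A] [Algebra 𝕜 A]
    {x p q : A} (hqx : Commute q x) (hp : p ∈ Submodule.span 𝕜 {1, x}) : Commute q p :=
  commute_map_of_mem_span LinearMap.id (by simpa using hqx) hp

namespace Martindale

variable {R : Type*} [NonUnitalRing R] [IsPrimeRing R]

local notation "C" => extendedCentroid R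
local notation "ι" => Qs.ofRing R

namespace Qs

theorem mk_mul_ofRing (p : SymMul R) {x : R} (hx : x ∈ p.dom) : mk p * ι x = ι (p.l x) :=
  mk_eq fun y hy _ =>
    ⟨p.l_mul x hx y, (p.balanced y (mulIdeal_le_right _ _ hy) x hx).symm⟩

theorem exists_ideal_mul_ofRing (q : Qs R) :
    ∃ I : TwoSidedIdeal R, I ≠ ⊥ ∧ ∀ x ∈ I, ∃ y, q * ι x = ι y := by
  obtain ⟨p⟩ := q
  exact ⟨p.dom, p.dom_ne, fun x hx => ⟨_, mk_mul_ofRing p hx⟩⟩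

theorem ofRing_injective : Function.Injective ι := by
  refine (injective_iff_map_eq_zero _).2 fun a ha => ?_
  obtain ⟨K, hK, -, -, h⟩ := Quotient.exact (s := SymMul.setoid R) ha
  obtain ⟨k, hk, hk0⟩ := exists_mem_ne_zero hK
  refine (IsPrimeRing.eq_zero_or_eq_zero a k fun r => ?_).resolve_right hk0
  have hrk : a * (r * k) = 0 * (r * k) := (h (r * k) (K.mul_mem_left _ _ hk)).1
  rw [mul_assoc, hrk, zero_mul]

theorem ofRing_eq_zero {a : R} : ι a = 0 ↔ a = 0 :=
  map_eq_zero_iff _ ofRing_injective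

theorem eq_zero_of_mul_ofRing {q : Qs R} {I : TwoSidedIdeal R} (hI : I ≠ ⊥)
    (h : ∀ x ∈ I, q * ι x = 0) : q = 0 := by
  obtain ⟨p⟩ := q
  have hJ := inf_ne_bot hI p.dom_ne
  have left_zero : ∀ x ∈ I ⊓ p.dom, p.l x = 0 := fun x hx => by
    have hx := (TwoSidedIdeal.mem_inf R).1 hx
    rw [← ofRing_eq_zero, ← mk_mul_ofRing p hx.2]
    exact h x hx.1
  have right_zero : ∀ x ∈ I ⊓ p.dom, p.r x = 0 := fun x hx => by
    obtain ⟨k, hk, hk0⟩ := exists_mem_ne_zero hJ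
    refine (IsPrimeRing.eq_zero_or_eq_zero _ k fun r => ?_).resolve_right hk0
    have hrk := (I ⊓ p.dom).mul_mem_left r _ hk
    rw [mul_assoc, ← p.balanced x ((TwoSidedIdeal.mem_inf R).1 hx).2 _
      ((TwoSidedIdeal.mem_inf R).1 hrk).2, left_zero _ hrk, mul_zero]
  exact Quotient.sound ⟨I ⊓ p.dom, hJ, inf_le_right, le_top, fun x hx =>
    ⟨(left_zero x hx).trans (zero_mul x).symm, (right_zero x hx).trans (mul_zero x).symm⟩⟩

theorem exists_mul_ofRing_ne_zero {q : Qs R} (hq : q ≠ 0) {I : TwoSidedIdeal R} (hI : I ≠ ⊥) :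
    ∃ x ∈ I, q * ι x ≠ 0 := by
  by_contra! h
  exact hq (eq_zero_of_mul_ofRing hI h)

theorem eq_zero_or_eq_zero_of_mul_ofRing_mul {p q : Qs R} (h : ∀ r, p * ι r * q = 0) :
    p = 0 ∨ q = 0 := by
  by_contra! ⟨hp, hq⟩
  obtain ⟨I, hI, hpI⟩ := exists_ideal_mul_ofRing p
  obtain ⟨J, hJ, hqJ⟩ := exists_ideal_mul_ofRing q
  obtain ⟨i, hi, hpi⟩ := exists_mul_ofRing_ne_zero hp hI
  obtain ⟨j, hj, hqj⟩ := exists_mul_ofRing_ne_zero hq hJ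
  obtain ⟨u, hu⟩ := hpI i hi
  obtain ⟨v, hv⟩ := hqJ j hj
  rw [hu, Ne, ofRing_eq_zero] at hpi
  rw [hv, Ne, ofRing_eq_zero] at hqj
  refine (IsPrimeRing.eq_zero_or_eq_zero u v fun r => ofRing_eq_zero.1 ?_).elim hpi hqj
  calc ι (u * r * v) = p * ι (i * r) * q * ι j := by simp only [map_mul, ← hu, ← hv, mul_assoc]
    _ = 0 := by rw [h, zero_mul]

theorem eq_of_forall_mul_ofRing_mul_eq {a b c : Qs R} (ha : a ≠ 0)
    (h : ∀ r, a * ι r * b = a * ι r * c) : b = c :=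
  sub_eq_zero.1 <| (eq_zero_or_eq_zero_of_mul_ofRing_mul fun r => by
    rw [mul_sub, h, sub_self]).resolve_left ha

theorem mem_extendedCentroid_iff {q : Qs R} : q ∈ C ↔ ∀ r, Commute q (ι r) := by
  refine ⟨fun h r => (Subring.mem_center_iff.1 h _).symm,
    fun h => Subring.mem_center_iff.2 fun p => sub_eq_zero.1 ?_⟩
  obtain ⟨I, hI, hpI⟩ := exists_ideal_mul_ofRing p
  refine eq_zero_of_mul_ofRing hI fun x hx => ?_
  obtain ⟨y, hy⟩ := hpI x hx
  rw [sub_mul, mul_assoc, mul_assoc, hy, (h x).eq, (h y).eq, ← mul_assoc, hy, sub_self]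

theorem ofRing_mem_extendedCentroid_iff {x : R} : ι x ∈ C ↔ x ∈ Set.center R := by
  simp only [mem_extendedCentroid_iff, commute_map_iff ofRing_injective,
    Semigroup.mem_center_iff, commute_iff_eq, eq_comm]

theorem exists_lie_ne_zero {q : Qs R} (h : q ∉ C) : ∃ r, ⁅q, ι r⁆ ≠ 0 := by
  simpa only [mem_extendedCentroid_iff, commute_iff_lie_eq, not_forall] using h

theorem ne_zero_of_notMem {q : Qs R} (h : q ∉ C) : q ≠ 0 := by
  rintro rfl
  exact h (zero_mem _)

instance : Nontrivial (Qs R) := by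
  obtain ⟨x, hx⟩ := exists_ne (0 : R)
  exact ⟨ι x, 0, fun h => hx (ofRing_eq_zero.1 h)⟩

theorem mem_extendedCentroid_of_forall_lie_mul_eq_zero {a : Qs R} (h : ∀ r, ⁅a, ι r⁆ * a = 0) :
    a ∈ C := by
  by_contra ha
  obtain ⟨r, hr⟩ := exists_lie_ne_zero ha
  refine (eq_zero_or_eq_zero_of_mul_ofRing_mul fun s => ?_).elim hr (ne_zero_of_notMem ha)
  calc ⁅a, ι r⁆ * ι s * a = ⁅a, ι (r * s)⁆ * a - ι r * (⁅a, ι s⁆ * a) := by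
        simp only [map_mul, Ring.lie_def]; noncomm_ring
    _ = 0 := by rw [h, h, mul_zero, sub_zero]

theorem exists_smul_ofRing_eq {D : TwoSidedIdeal R} (hD : D ≠ ⊥) {f : R → R}
    (map_add : ∀ x ∈ D, ∀ y ∈ D, f (x + y) = f x + f y)
    (map_mul_right : ∀ x ∈ D, ∀ a, f (x * a) = f x * a)
    (map_mul_left : ∀ x ∈ D, ∀ a, f (a * x) = a * f x) :
    ∃ k : C, ∀ x ∈ D, k • ι x = ι (f x) := by
  let k : SymMul R :=
    { dom := D, dom_ne := hD, l := f, r := f, l_add := map_add, r_add := map_add,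
      l_mul := map_mul_right, r_mul := map_mul_left
      balanced := fun x hx y hy => by rw [← map_mul_left y hy, map_mul_right x hx] }
  refine ⟨⟨mk k, mem_extendedCentroid_iff.2 fun r => sub_eq_zero.1 ?_⟩,
    fun x hx => mk_mul_ofRing k hx⟩
  refine eq_zero_of_mul_ofRing hD fun x hx => ?_
  rw [sub_mul, mul_assoc, mul_assoc, mk_mul_ofRing k hx, ← map_mul,
    mk_mul_ofRing k (D.mul_mem_left _ _ hx), ← map_mul, sub_eq_zero]
  exact congrArg ι (map_mul_left x hx r)

/-- The ideal of all `z ∈ R` such that `k z ∈ R`, where `k` is the ratio of `c` to `a`, that is,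
the element of `C` with `c = k a`. The witness `w` stands for `k z`, so that the ideal can be
defined before `k` is known to exist. -/
def ratioIdeal (a c : Qs R) : TwoSidedIdeal R :=
  TwoSidedIdeal.mk' {z | ∃ w, ∀ r, a * ι r * ι w = c * ι r * ι z}
    ⟨0, fun r => by simp⟩
    (fun ⟨w, hw⟩ ⟨w', hw'⟩ => ⟨w + w', fun r => by simp only [map_add, mul_add, hw, hw']⟩)
    (fun ⟨w, hw⟩ => ⟨-w, fun r => by simp only [map_neg, mul_neg, hw]⟩)
    (fun {x _} ⟨w, hw⟩ => ⟨x * w, fun r => by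
      simpa only [map_mul, mul_assoc] using hw (r * x)⟩)
    (fun {_ y} ⟨w, hw⟩ => ⟨w * y, fun r => by
      rw [map_mul, map_mul, ← mul_assoc, ← mul_assoc, hw]⟩)

theorem mem_ratioIdeal {a c : Qs R} {z : R} :
    z ∈ ratioIdeal a c ↔ ∃ w, ∀ r, a * ι r * ι w = c * ι r * ι z :=
  TwoSidedIdeal.mem_mk' _ _ _ _ _ _ _

theorem exists_eq_smul_of_ratioIdeal_ne_bot {a c : Qs R} (ha : a ≠ 0) (h : ratioIdeal a c ≠ ⊥) :
    ∃ k : C, c = k • a := by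
  choose! f hf using fun z (hz : z ∈ ratioIdeal a c) => mem_ratioIdeal.1 hz
  have f_unique : ∀ z ∈ ratioIdeal a c, ∀ w,
      (∀ r, a * ι r * ι w = c * ι r * ι z) → f z = w := fun z hz w hw =>
    ofRing_injective (eq_of_forall_mul_ofRing_mul_eq ha fun r => by rw [hf z hz, hw])
  obtain ⟨k, hk⟩ := exists_smul_ofRing_eq h (f := f)
    (fun x hx y hy => f_unique _ (add_mem hx hy) _ fun r => by
      simp only [map_add, mul_add, hf x hx, hf y hy])
    (fun x hx t => f_unique _ (TwoSidedIdeal.mul_mem_right _ _ _ hx) _ fun r => by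
      simp only [map_mul, ← mul_assoc, hf x hx])
    (fun x hx t => f_unique _ (TwoSidedIdeal.mul_mem_left _ _ _ hx) _ fun r => by
      simpa only [map_mul, mul_assoc] using hf x hx (r * t))
  refine ⟨k, sub_eq_zero.1 ?_⟩
  obtain ⟨z, hz, hz0⟩ := exists_mem_ne_zero h
  refine (eq_zero_or_eq_zero_of_mul_ofRing_mul fun r => ?_).resolve_right
    (mt ofRing_eq_zero.1 hz0)
  rw [sub_mul, sub_mul, ← hf z hz, ← hk z hz, mul_smul_comm, smul_mul_assoc, smul_mul_assoc,
    sub_self]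

theorem ratioIdeal_ne_bot {a b c d : Qs R} (hd : d ≠ 0) (h : ∀ r, a * ι r * b = c * ι r * d) :
    ratioIdeal a c ≠ ⊥ := by
  obtain ⟨I, hI, hbI⟩ := exists_ideal_mul_ofRing b
  obtain ⟨J, hJ, hdJ⟩ := exists_ideal_mul_ofRing d
  obtain ⟨i, hi, hdi⟩ := exists_mul_ofRing_ne_zero hd (inf_ne_bot hI hJ)
  obtain ⟨hiI, hiJ⟩ := (TwoSidedIdeal.mem_inf R).1 hi
  obtain ⟨w, hw⟩ := hbI i hiI
  obtain ⟨z, hz⟩ := hdJ i hiJ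
  have hz_mem : z ∈ ratioIdeal a c :=
    mem_ratioIdeal.2 ⟨w, fun r => by rw [← hw, ← hz, ← mul_assoc, ← mul_assoc, h]⟩
  intro hbot
  rw [hbot, TwoSidedIdeal.mem_bot] at hz_mem
  exact hdi (by rw [hz, hz_mem, map_zero])

theorem exists_smul_eq_of_mul_ofRing_mul_eq {a b c d : Qs R} (ha : a ≠ 0) (hd : d ≠ 0)
    (h : ∀ r, a * ι r * b = c * ι r * d) : ∃ k : C, c = k • a ∧ b = k • d := by
  obtain ⟨k, hk⟩ := exists_eq_smul_of_ratioIdeal_ne_bot ha (ratioIdeal_ne_bot hd h)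
  refine ⟨k, hk, eq_of_forall_mul_ofRing_mul_eq ha fun r => ?_⟩
  rw [h, hk, mul_smul_comm, smul_mul_assoc, smul_mul_assoc]

theorem extendedCentroid_isUnit_or_eq_zero (k : C) : IsUnit k ∨ k = 0 := by
  refine or_iff_not_imp_right.2 fun hk => ?_
  have hk0 : (k : Qs R) ≠ 0 := fun h => hk (Subtype.ext h)
  obtain ⟨k', h, -⟩ := exists_smul_eq_of_mul_ofRing_mul_eq (b := 1) (c := 1) hk0 hk0 fun r => by
    rw [one_mul, mul_one, Subring.mem_center_iff.1 k.2]
  exact .of_mul_eq_one_right k' (Subtype.ext h.symm)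

end Qs

open Qs Submodule

/-- The field structure on the extended centroid. It extends the commutative ring structure which
`C` has as a subring of `Q_s(R)`, so that `C`-modules are the same for both structures. -/
noncomputable abbrev extendedCentroidField : Field C :=
  Field.ofIsUnitOrEqZero extendedCentroid_isUnit_or_eq_zero

attribute [local instance] extendedCentroidField

theorem mem_extendedCentroid_of_smul_mem {k : C} (hk : k ≠ 0) {q : Qs R} (hq : k • q ∈ C) :
    q ∈ C := by
  have h := mul_mem (k⁻¹).2 hq
  rwa [← smul_eq_mul, ← Subring.smul_def, inv_smul_smul₀ hk] at h

theorem mem_span_one_iff {q : Qs R} : q ∈ span C {1} ↔ q ∈ C := by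
  rw [mem_span_singleton]
  refine ⟨?_, fun h => ⟨⟨q, h⟩, mul_one q⟩⟩
  rintro ⟨k, rfl⟩
  exact mul_mem k.2 (one_mem _)

theorem mem_span_one_pair_of_mem {q x : Qs R} (h : q ∈ C) : q ∈ span C {1, x} :=
  span_mono (by simp) (mem_span_one_iff.2 h)

theorem span_one_pair_eq {p x : Qs R} (hp : p ∉ C) (hpx : p ∈ span C {1, x}) :
    span C {1, p} = span C {1, x} := by
  have hx : x ∈ span C {1, p} := by
    rw [Set.pair_comm] at hpx ⊢
    exact mem_span_insert_exchange hpx (mt mem_span_one_iff.1 hp)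
  apply le_antisymm <;> refine span_le.2 (Set.pair_subset (subset_span (by simp)) ?_)
  exacts [hpx, hx]

theorem finrank_span_one_pair {x : Qs R} (hx : x ∉ C) :
    Module.finrank C (span C {1, x}) = 2 := by
  have linearIndependent : LinearIndependent C ![1, x] := by
    refine (LinearIndependent.pair_iff' one_ne_zero).2 fun k hk => hx ?_
    exact mem_span_one_iff.1 (mem_span_singleton.2 ⟨k, hk⟩)
  have finrank_range := finrank_span_eq_card linearIndependent
  rwa [Matrix.range_cons_cons_empty, Fintype.card_fin] at finrank_range

theorem sq_mem_of_mem_span_one_pair [CharP (Qs R) 2] {x p : Qs R} (hx : x ^ 2 ∈ C)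
    (hp : p ∈ span C {1, x}) : p ^ 2 ∈ C := by
  obtain ⟨s, t, rfl⟩ := mem_span_pair.1 hp
  rw [add_pow_char_of_commute 2 ((Commute.one_left x).smul_left s |>.smul_right t), smul_pow,
    smul_pow, one_pow]
  exact add_mem (mul_mem (s ^ 2).2 (one_mem _)) (mul_mem (t ^ 2).2 hx)

theorem sq_mem_of_lie_lie_eq_zero [CharP (Qs R) 2] {x : Qs R} (h : ∀ r, ⁅x, ⁅x, ι r⁆⁆ = 0) :
    x ^ 2 ∈ C := by
  refine mem_extendedCentroid_iff.2 fun r => commute_iff_lie_eq.2 ?_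
  calc ⁅x ^ 2, ι r⁆ = ⁅x, ⁅x, ι r⁆⁆ + 2 * (x * ι r * x - ι r * x ^ 2) := by
        simp only [Ring.lie_def]; noncomm_ring
    _ = 0 := by rw [h, CharTwo.two_eq_zero, zero_mul, add_zero]

theorem charP_two_and_exists_add_smul_mem {a x : Qs R} (ha : a ∉ C) (hx : x ∉ C)
    (h : ∀ r, ⁅a, ⁅x, ι r⁆⁆ = 0) : CharP (Qs R) 2 ∧ ∃ k : C, k ≠ 0 ∧ a + k • x ∈ C := by
  have anticomm (r t s : R) : ⁅a, ι r⁆ * ι t * ⁅x, ι s⁆ = -(⁅x, ι r⁆ * ι t * ⁅a, ι s⁆) :=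
    lie_mul_mul_lie_eq_neg (ι : R →ₙ* Qs R) h r t s
  obtain ⟨s, hs⟩ := exists_lie_ne_zero hx
  obtain ⟨k, hk, hk_neg⟩ : ∃ k : C, ⁅a, ι s⁆ = k • ⁅x, ι s⁆ ∧ -⁅a, ι s⁆ = k • ⁅x, ι s⁆ :=
    exists_smul_eq_of_mul_ofRing_mul_eq hs hs fun r => by rw [anticomm, mul_neg]
  have add_mem_center : a + k • x ∈ C := mem_extendedCentroid_iff.2 fun r => by
    refine commute_iff_lie_eq.2 ?_
    refine (eq_zero_or_eq_zero_of_mul_ofRing_mul fun t => ?_).resolve_right hs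
    have lie_eq : ⁅a + k • x, ι r⁆ = ⁅a, ι r⁆ + k • ⁅x, ι r⁆ := by
      simp only [Ring.lie_def, add_mul, mul_add, smul_mul_assoc, mul_smul_comm, smul_sub]; abel
    rw [lie_eq, add_mul, add_mul, anticomm, hk, mul_smul_comm, smul_mul_assoc, smul_mul_assoc,
      neg_add_cancel]
  have hk0 : k ≠ 0 := by
    rintro rfl
    exact ha (by simpa using add_mem_center)
  have two_smul_eq_zero : ((2 : C) * k) • ⁅x, ι s⁆ = 0 := by
    calc ((2 : C) * k) • ⁅x, ι s⁆ = k • ⁅x, ι s⁆ + k • ⁅x, ι s⁆ := by rw [mul_smul, two_smul]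
      _ = ⁅a, ι s⁆ + -⁅a, ι s⁆ := congrArg₂ (· + ·) hk.symm hk_neg.symm
      _ = 0 := add_neg_cancel _
  have two_eq_zero : (2 : C) = 0 := by
    simpa [hs, hk0] using two_smul_eq_zero
  exact ⟨CharTwo.of_one_ne_zero_of_two_eq_zero one_ne_zero (congrArg Subtype.val two_eq_zero),
    k, hk0, add_mem_center⟩

theorem charP_two_and_sq_mem_and_mem_span {a x : Qs R} (ha : a ∉ C) (hx : x ∉ C)
    (h : ∀ r, ⁅a, ⁅x, ι r⁆⁆ = 0) :
    CharP (Qs R) 2 ∧ x ^ 2 ∈ C ∧ a ∈ span C {1, x} := by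
  obtain ⟨_, k, hk, hc⟩ := charP_two_and_exists_add_smul_mem ha hx h
  refine ⟨‹_›, sq_mem_of_lie_lie_eq_zero fun r => ?_, ?_⟩
  · have hsmul : k • ⁅x, ⁅x, ι r⁆⁆ = ⁅a + k • x, ⁅x, ι r⁆⁆ - ⁅a, ⁅x, ι r⁆⁆ := by
      simp only [Ring.lie_def, add_mul, mul_add, smul_mul_assoc, mul_smul_comm, smul_sub]; abel
    have hcomm : ⁅a + k • x, ⁅x, ι r⁆⁆ = 0 :=
      sub_eq_zero.2 (Subring.mem_center_iff.1 hc _).symm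
    rw [hcomm, h, sub_zero] at hsmul
    exact (smul_eq_zero.1 hsmul).resolve_left hk
  · have ha_eq : a = (a + k • x) - k • x := (add_sub_cancel_right _ _).symm
    rw [ha_eq]
    exact sub_mem (mem_span_one_pair_of_mem hc) (smul_mem _ _ (subset_span (by simp)))

section LieIdeal

variable {K : AddSubgroup R}

theorem ofRing_mem_extend {A : Set R} {a : R} (ha : a ∈ A) : ι a ∈ extend A :=
  subset_span ⟨a, ha, rfl⟩

theorem extend_le_centralClosure (A : Set R) : extend A ≤ centralClosure R :=
  span_mono (Set.image_mono (Set.subset_univ A))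

theorem ofRing_lie_mem_image (hK : IsLieIdeal K) {k : R} (hk : k ∈ K) (r : R) :
    ⁅ι k, ι r⁆ ∈ ι '' K :=
  ⟨_, hK k hk r, by simp only [map_sub, map_mul, Ring.lie_def]⟩

theorem exists_notMem_extendedCentroid {S : Set R} (hS : ¬ S ⊆ Set.center R) :
    ∃ k ∈ S, ι k ∉ C := by
  obtain ⟨k, hk, h⟩ := Set.not_subset.1 hS
  exact ⟨k, hk, mt ofRing_mem_extendedCentroid_iff.1 h⟩

theorem lie_lie_eq_zero_of_commute (hK : IsLieIdeal K) {y : Qs R}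
    (hy : ∀ k ∈ K, Commute y (ι k)) {k : R} (hk : k ∈ K) (r : R) : ⁅ι k, ⁅y, ι r⁆⁆ = 0 := by
  obtain ⟨l, hl, hlie⟩ := ofRing_lie_mem_image hK hk r
  calc ⁅ι k, ⁅y, ι r⁆⁆ = ⁅y, ⁅ι k, ι r⁆⁆ - ⁅⁅y, ι k⁆, ι r⁆ := by
        simp only [Ring.lie_def]; noncomm_ring
    _ = 0 := by rw [← hlie, (hy l hl).lie_eq, (hy k hk).lie_eq]; simp [Ring.lie_def]

theorem charP_two_and_sq_mem_of_commute (hK : IsNoncentralLieIdeal K) {y : Qs R} (hyC : y ∉ C)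
    (hy : ∀ k ∈ K, Commute y (ι k)) : CharP (Qs R) 2 ∧ y ^ 2 ∈ C := by
  obtain ⟨k, hk, hkC⟩ := exists_notMem_extendedCentroid hK.not_subset_center
  obtain ⟨hchar, hsq, -⟩ := charP_two_and_sq_mem_and_mem_span hkC hyC
    (lie_lie_eq_zero_of_commute hK.isLieIdeal hy hk)
  exact ⟨hchar, hsq⟩

theorem extend_le_span_one_pair_of_commute (hK : IsLieIdeal K) {y : Qs R} (hyC : y ∉ C)
    (hy : ∀ k ∈ K, Commute y (ι k)) : extend (K : Set R) ≤ span C {1, y} := by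
  refine span_le.2 ?_
  rintro _ ⟨k, hk, rfl⟩
  by_cases hkC : ι k ∈ C
  · exact mem_span_one_pair_of_mem hkC
  · exact (charP_two_and_sq_mem_and_mem_span hkC hyC (lie_lie_eq_zero_of_commute hK hy hk)).2.2

theorem one_mem_extend_of_le_span (hK : IsLieIdeal K) {k : R} (hk : k ∈ K) (hkC : ι k ∉ C)
    (hsq : ι k ^ 2 ∈ C) (hle : extend (K : Set R) ≤ span C {1, ι k}) :
    1 ∈ extend (K : Set R) := by
  by_contra hone
  have eq_zero_of_smul_one_mem (c : C) (hc : c • (1 : Qs R) ∈ extend (K : Set R)) : c = 0 := by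
    by_contra hc0
    exact hone ((smul_mem_iff _ hc0).1 hc)
  have lie_mem (r : R) : ⁅ι k, ι r⁆ ∈ extend (K : Set R) :=
    subset_span (ofRing_lie_mem_image hK hk r)
  refine hkC (mem_extendedCentroid_of_forall_lie_mul_eq_zero fun r => ?_)
  have lie_eq_smul : ∃ t : C, ⁅ι k, ι r⁆ = t • ι k := by
    obtain ⟨s, t, hst⟩ := mem_span_pair.1 (hle (lie_mem r))
    have hs : s = 0 := eq_zero_of_smul_one_mem s <| by
      rw [eq_sub_of_add_eq hst]
      exact sub_mem (lie_mem r) (smul_mem _ _ (ofRing_mem_extend hk))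
    exact ⟨t, by rw [← hst, hs, zero_smul, zero_add]⟩
  have lie_mul_mem_extend : ⁅ι k, ι r⁆ * ι k ∈ extend (K : Set R) := by
    have lie_mul : ⁅ι k, ι r⁆ * ι k = ⁅ι k, ι (r * k)⁆ := by
      simp only [map_mul, Ring.lie_def]; noncomm_ring
    exact lie_mul ▸ lie_mem (r * k)
  have lie_mul_mem_center : ⁅ι k, ι r⁆ * ι k ∈ C := by
    obtain ⟨t, ht⟩ := lie_eq_smul
    rw [ht, smul_mul_assoc, ← pow_two]
    exact mul_mem t.2 hsq
  obtain ⟨c, hc⟩ := mem_span_singleton.1 (mem_span_one_iff.2 lie_mul_mem_center)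
  rw [← hc, eq_zero_of_smul_one_mem c (hc ▸ lie_mul_mem_extend), zero_smul]

theorem extend_eq_span_one_pair_of_commute (hK : IsNoncentralLieIdeal K) {y : Qs R} (hyC : y ∉ C)
    (hy : ∀ k ∈ K, Commute y (ι k)) : extend (K : Set R) = span C {1, y} := by
  obtain ⟨k, hk, hkC⟩ := exists_notMem_extendedCentroid hK.not_subset_center
  obtain ⟨_, hsq⟩ := charP_two_and_sq_mem_of_commute hK hyC hy
  have hle := extend_le_span_one_pair_of_commute hK.isLieIdeal hyC hy
  have hk_span := hle (ofRing_mem_extend hk)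
  rw [← span_one_pair_eq hkC hk_span] at hle ⊢
  have one_mem := one_mem_extend_of_le_span hK.isLieIdeal hk hkC
    (sq_mem_of_mem_span_one_pair hsq hk_span) hle
  exact le_antisymm hle (span_le.2 (Set.pair_subset one_mem (ofRing_mem_extend hk)))

theorem one_mem_extend_of_commute (hK : IsNoncentralLieIdeal K) {y : Qs R} (hyC : y ∉ C)
    (hy : ∀ k ∈ K, Commute y (ι k)) : 1 ∈ extend (K : Set R) := by
  rw [extend_eq_span_one_pair_of_commute hK hyC hy]
  exact subset_span (by simp)

theorem centralizer_eq_extend_of_commute (hK : IsNoncentralLieIdeal K) {y : Qs R} (hyC : y ∉ C)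
    (hy : ∀ k ∈ K, Commute y (ι k)) : Set.centralizer (ι '' K) = extend (K : Set R) := by
  have extend_eq := extend_eq_span_one_pair_of_commute hK hyC hy
  ext q
  rw [Set.mem_centralizer_iff, Set.forall_mem_image, SetLike.mem_coe]
  refine ⟨fun hq => ?_, fun hq k hk => ?_⟩
  · by_cases hqC : q ∈ C
    · exact extend_eq ▸ mem_span_one_pair_of_mem hqC
    · rw [extend_eq_span_one_pair_of_commute hK hqC fun k hk => (hq hk).symm]
      exact subset_span (by simp)
  · exact commute_of_mem_span_one_pair (hy k hk).symm (extend_eq ▸ hq)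

theorem commute_of_mul_mul_eq_zero (hK : IsLieIdeal K) {u : Qs R}
    (hu : ∀ k ∈ K, u * ι k * u = 0) {k : R} (hk : k ∈ K) : Commute u (ι k) := by
  by_cases hu0 : u = 0
  · exact hu0 ▸ Commute.zero_left _
  have balanced (r : R) : u * ι r * (ι k * u) = u * ι k * ι r * u := by
    obtain ⟨l, hl, hlie⟩ := ofRing_lie_mem_image hK hk r
    have hlu := hu l hl
    rw [hlie, Ring.lie_def, mul_sub, sub_mul, sub_eq_zero] at hlu
    simpa only [mul_assoc] using hlu.symm
  obtain ⟨c, huk, hku⟩ := exists_smul_eq_of_mul_ofRing_mul_eq hu0 hu0 balanced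
  exact huk.trans hku.symm

theorem commute_of_commute_mul (hK : IsLieIdeal K) {u : Qs R} (hsq : u ^ 2 ∈ C)
    (hu : ∀ k ∈ K, Commute u (u * ι k)) {k : R} (hk : k ∈ K) : Commute u (ι k) := by
  by_cases hsq0 : u ^ 2 = 0
  · refine commute_of_mul_mul_eq_zero hK (fun k hk => ?_) hk
    rw [← (hu k hk).eq, ← mul_assoc, ← pow_two, hsq0, zero_mul]
  · have smul_lie : (⟨u ^ 2, hsq⟩ : C) • ⁅u, ι k⁆ = u * ⁅u, u * ι k⁆ := by
      rw [Subring.smul_def, smul_eq_mul, Ring.lie_def, Ring.lie_def]; noncomm_ring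
    rw [(hu k hk).lie_eq, mul_zero] at smul_lie
    exact commute_iff_lie_eq.2 <| (smul_eq_zero.1 smul_lie).resolve_left fun h =>
      hsq0 (congrArg Subtype.val h)

theorem ofRing_mem_extendedCentroid_of_forall_lie_mem {b : R} (h : ∀ s, ⁅ι b, ι s⁆ ∈ C) :
    ι b ∈ C := by
  by_contra hb
  obtain ⟨s, hs⟩ := exists_lie_ne_zero hb
  have hc0 : (⟨_, h s⟩ : C) ≠ 0 := fun hc => hs (congrArg Subtype.val hc)
  refine hb (mem_extendedCentroid_of_smul_mem hc0 ?_)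
  have smul_eq : (⟨_, h s⟩ : C) • ι b = ⁅ι b, ι (s * b)⁆ := by
    simp only [Subring.smul_def, smul_eq_mul, map_mul, Ring.lie_def]; noncomm_ring
  exact smul_eq ▸ h (s * b)

end LieIdeal

section Product

variable {A B : AddSubgroup R}

theorem mul_eq_zero_of_forall_mul_mem (hB : IsLieIdeal B) {a : Qs R} (ha : a ∉ C)
    (h : ∀ b ∈ B, a * ι b ∈ C) {b : R} (hb : b ∈ B) : a * ι b = 0 := by
  by_contra hab
  have hc0 : (⟨_, h b hb⟩ : C) ≠ 0 := fun hc => hab (congrArg Subtype.val hc)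
  have lie_mem_center (s : R) : ⁅ι b, ι s⁆ ∈ C := by
    obtain ⟨l, hl, hlie⟩ := ofRing_lie_mem_image hB hb (b * s)
    refine mem_extendedCentroid_of_smul_mem hc0 ?_
    have smul_lie : (⟨_, h b hb⟩ : C) • ⁅ι b, ι s⁆ = a * ι l := by
      rw [hlie]
      simp only [Subring.smul_def, smul_eq_mul, map_mul, Ring.lie_def]; noncomm_ring
    exact smul_lie ▸ h l hl
  have hbC : ι b ∈ C := ofRing_mem_extendedCentroid_of_forall_lie_mem lie_mem_center
  have hb0 : (⟨_, hbC⟩ : C) ≠ 0 := fun hc => hab <| by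
    rw [show ι b = 0 from congrArg Subtype.val hc, mul_zero]
  refine ha (mem_extendedCentroid_of_smul_mem hb0 ?_)
  rw [Subring.smul_def, smul_eq_mul, ← Subring.mem_center_iff.1 hbC]
  exact h b hb

theorem not_mul_subset_center (hA : ¬ (A : Set R) ⊆ Set.center R) (hB : IsNoncentralLieIdeal B) :
    ¬ ((A * B : AddSubgroup R) : Set R) ⊆ Set.center R := by
  intro hAB
  obtain ⟨a, ha, haC⟩ := exists_notMem_extendedCentroid hA
  obtain ⟨b, hb, hbC⟩ := exists_notMem_extendedCentroid hB.not_subset_center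
  have mul_eq_zero {b : R} (hb : b ∈ B) : ι a * ι b = 0 :=
    mul_eq_zero_of_forall_mul_mem hB.isLieIdeal haC (fun b hb => by
      rw [← map_mul, ofRing_mem_extendedCentroid_iff]
      exact hAB (mul_mem_addSubgroup_mul ha hb)) hb
  refine (eq_zero_or_eq_zero_of_mul_ofRing_mul fun r => ?_).elim
    (ne_zero_of_notMem haC) (ne_zero_of_notMem hbC)
  obtain ⟨l, hl, hlie⟩ := ofRing_lie_mem_image hB.isLieIdeal hb r
  calc ι a * ι r * ι b = ι a * ι b * ι r - ι a * ⁅ι b, ι r⁆ := by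
        rw [Ring.lie_def]; noncomm_ring
    _ = 0 := by rw [← hlie, mul_eq_zero hb, mul_eq_zero hl, zero_mul, sub_zero]

theorem _root_.IsNoncentralLieIdeal.mul (hA : IsNoncentralLieIdeal A)
    (hB : IsNoncentralLieIdeal B) : IsNoncentralLieIdeal (A * B) :=
  ⟨hA.isLieIdeal.mul hB.isLieIdeal, not_mul_subset_center hA.not_subset_center hB⟩

theorem _root_.IsNoncentralLieIdeal.prodSubgroups {m : ℕ} {K : Fin (m + 1) → AddSubgroup R}
    (hK : ∀ j, IsNoncentralLieIdeal (K j)) : IsNoncentralLieIdeal (prodSubgroups m K) := by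
  induction m with
  | zero => exact hK 0
  | succ m ih => exact (ih fun i => hK i.castSucc).mul (hK _)

theorem commute_of_mul_mem_span_one_pair [CharP (Qs R) 2] (hB : IsLieIdeal B) {x u : Qs R}
    (hsq : x ^ 2 ∈ C) (hu0 : u ≠ 0) (hu : u ∈ span C {1, x})
    (hmul : ∀ b ∈ B, u * ι b ∈ span C {1, x}) : ∀ b ∈ B, Commute x (ι b) := by
  intro b hb
  have commute_mul {b : R} (hb : b ∈ B) : Commute x (u * ι b) :=
    commute_of_mem_span_one_pair (Commute.refl x) (hmul b hb)
  have commute_u : Commute u (ι b) :=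
    commute_of_commute_mul hB (sq_mem_of_mem_span_one_pair hsq hu)
      (fun b hb => (commute_of_mem_span_one_pair (commute_mul hb).symm hu).symm) hb
  by_cases huC : u ∈ C
  · have hc0 : (⟨u, huC⟩ : C) ≠ 0 := fun h => hu0 (congrArg Subtype.val h)
    exact (Commute.smul_right_iff₀ hc0).1 (commute_mul hb)
  · have hx : x ∈ span C {1, u} := span_one_pair_eq huC hu ▸ subset_span (by simp)
    exact (commute_of_mem_span_one_pair commute_u.symm hx).symm

theorem commute_right_of_commute_mul (hA : IsNoncentralLieIdeal A) (hB : IsNoncentralLieIdeal B)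
    {x : Qs R} (hx : x ∉ C) (h : ∀ p ∈ A * B, Commute x (ι p)) : ∀ b ∈ B, Commute x (ι b) := by
  have hAB := hA.mul hB
  have extend_eq := extend_eq_span_one_pair_of_commute hAB hx h
  obtain ⟨_, hsq⟩ := charP_two_and_sq_mem_of_commute hAB hx h
  have mem_span {p : R} (hp : p ∈ A * B) : ι p ∈ span C {1, x} :=
    extend_eq ▸ ofRing_mem_extend hp
  obtain ⟨p, hp, hpC⟩ := exists_notMem_extendedCentroid hAB.not_subset_center
  by_cases hpA : ∀ a ∈ A, Commute (ι p) (ι a)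
  · have hx_span : x ∈ span C {1, ι p} :=
      span_one_pair_eq hpC (mem_span hp) ▸ subset_span (by simp)
    have one_mem := one_mem_extend_of_commute hA hx fun a ha =>
      (commute_of_mem_span_one_pair (hpA a ha).symm hx_span).symm
    intro b hb
    simpa using commute_map_of_mem_span (LinearMap.mulRight C (ι b))
      (Set.forall_mem_image.2 fun a ha => by
        simpa using h _ (mul_mem_addSubgroup_mul ha hb)) one_mem
  · push Not at hpA
    obtain ⟨a, ha, hpa⟩ := hpA
    obtain ⟨u, hu, hu_lie⟩ := ofRing_lie_mem_image hA.isLieIdeal ha p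
    have hu_span : ι u ∈ span C {1, x} := by
      obtain ⟨q, hq, hq_lie⟩ := ofRing_lie_mem_image hAB.isLieIdeal hp a
      rw [hu_lie, Ring.lie_def, ← neg_sub, ← Ring.lie_def, ← hq_lie]
      exact neg_mem (mem_span hq)
    have hu0 : ι u ≠ 0 := fun h0 => hpa (commute_iff_lie_eq.2 (hu_lie ▸ h0)).symm
    refine commute_of_mul_mem_span_one_pair hB.isLieIdeal hsq hu0 hu_span fun b hb => ?_
    rw [← map_mul]
    exact mem_span (mul_mem_addSubgroup_mul hu hb)

theorem commute_left_of_commute_mul (hA : IsNoncentralLieIdeal A) (hB : IsNoncentralLieIdeal B)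
    {x : Qs R} (hx : x ∉ C) (h : ∀ p ∈ A * B, Commute x (ι p)) : ∀ a ∈ A, Commute x (ι a) := by
  intro a ha
  have one_mem := one_mem_extend_of_commute hB hx (commute_right_of_commute_mul hA hB hx h)
  simpa using commute_map_of_mem_span (LinearMap.mulLeft C (ι a))
    (Set.forall_mem_image.2 fun b hb => by
      simpa using h _ (mul_mem_addSubgroup_mul ha hb)) one_mem

theorem commute_of_commute_prodSubgroups {m : ℕ} {K : Fin (m + 1) → AddSubgroup R}
    (hK : ∀ j, IsNoncentralLieIdeal (K j)) {x : Qs R} (hx : x ∉ C)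
    (h : ∀ p ∈ prodSubgroups m K, Commute x (ι p)) (j) : ∀ k ∈ K j, Commute x (ι k) := by
  induction m with
  | zero => exact Fin.fin_one_eq_zero j ▸ h
  | succ m ih =>
    have hprod := IsNoncentralLieIdeal.prodSubgroups fun i : Fin (m + 1) => hK i.castSucc
    refine Fin.lastCases (commute_right_of_commute_mul hprod (hK _) hx h) (fun i => ?_) j
    exact ih (fun i => hK i.castSucc) (commute_left_of_commute_mul hprod (hK _) hx h) i

end Product

theorem centralizer_eq_center_of_centralizer_image_eq {S : Set R}
    (h : Set.centralizer (ι '' S) = (C : Set (Qs R))) : Set.centralizer S = Set.center R := by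
  ext x
  rw [← ofRing_mem_extendedCentroid_iff, ← SetLike.mem_coe, ← h, Set.mem_centralizer_iff,
    Set.mem_centralizer_iff, Set.forall_mem_image]
  simp only [← map_mul, ofRing_injective.eq_iff]

theorem centralClosure_inter_centralizer_eq_of_centralizer_image_eq {S A : Set R}
    (h : Set.centralizer (ι '' S) = (extend A : Set (Qs R))) :
    {x : Qs R | x ∈ centralClosure R ∧ ∀ a ∈ S, ι a * x = x * ι a} = extend A := by
  ext x
  rw [Set.mem_ofPred_eq, ← h, Set.mem_centralizer_iff, Set.forall_mem_image, and_iff_right_of_imp]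
  intro hx
  have hx_extend : x ∈ (extend A : Set (Qs R)) :=
    h ▸ Set.mem_centralizer_iff.2 (Set.forall_mem_image.2 hx)
  exact extend_le_centralClosure A hx_extend

theorem extend_eq_and_finrank_eq_two_and_centralizer_eq {m : ℕ} {K : Fin (m + 1) → AddSubgroup R}
    (hK : ∀ j, IsNoncentralLieIdeal (K j)) {x : Qs R} (hx : x ∉ C)
    (h : ∀ p ∈ prodSubgroups m K, Commute x (ι p)) :
    (∀ j, extend (K j : Set R) = extend (K 0 : Set R)) ∧
      Module.finrank C (extend (K 0 : Set R)) = 2 ∧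
      Set.centralizer (ι '' prodSubgroups m K) = (extend (K 0 : Set R) : Set (Qs R)) := by
  have hprod := IsNoncentralLieIdeal.prodSubgroups hK
  have extend_eq (j) : extend (K j : Set R) = span C {1, x} :=
    extend_eq_span_one_pair_of_commute (hK j) hx (commute_of_commute_prodSubgroups hK hx h j)
  refine ⟨fun j => (extend_eq j).trans (extend_eq 0).symm, ?_, ?_⟩
  · rw [extend_eq]
    exact finrank_span_one_pair hx
  · rw [centralizer_eq_extend_of_commute hprod hx h, extend_eq,
      extend_eq_span_one_pair_of_commute hprod hx h]

end Martindale

theorem mainTheorem10_general {R : Type*} [NonUnitalRing R] [IsPrimeRing R] (m : ℕ)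
    (K : Fin (m + 1) → AddSubgroup R) (hK : ∀ j, IsLieIdeal (K j))
    (hKZ : ∀ j, ¬ (K j : Set R) ⊆ Set.center R) :
    Set.centralizer (Martindale.Qs.ofRing R '' prodSubgroups m K) =
        (Martindale.extendedCentroid R : Set (Martindale.Qs R)) ∨
      ((∀ j, Martindale.extend (K j : Set R) = Martindale.extend (K 0 : Set R)) ∧
        Module.finrank (Martindale.extendedCentroid R) (Martindale.extend (K 0 : Set R)) = 2 ∧
        Set.centralizer (Martindale.Qs.ofRing R '' prodSubgroups m K) =
          (Martindale.extend (K 0 : Set R) : Set (Martindale.Qs R))) := by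
  refine or_iff_not_imp_left.2 fun hne => ?_
  have center_subset := Set.center_subset_centralizer (Martindale.Qs.ofRing R '' prodSubgroups m K)
  obtain ⟨x, hx, hxC⟩ := Set.not_subset.1 fun hsub => hne (hsub.antisymm center_subset)
  exact Martindale.extend_eq_and_finrank_eq_two_and_centralizer_eq (fun j => ⟨hK j, hKZ j⟩) hxC
    fun p hp => (hx _ (Set.mem_image_of_mem _ hp)).symm

theorem mainTheorem10 {R : Type*} [NonUnitalRing R] [IsPrimeRing R] (m : ℕ)
    (K : Fin (m + 1) → AddSubgroup R) (hK : ∀ j, IsLieIdeal (K j))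
    (hKZ : ∀ j, ¬ (K j : Set R) ⊆ Set.center R) :
    Set.centralizer (prodSubgroups m K : Set R) = Set.center R ∨
      ((∀ j, Martindale.extend (K j : Set R) = Martindale.extend (K 0 : Set R)) ∧
        Module.finrank (Martindale.extendedCentroid R) (Martindale.extend (K 0 : Set R)) = 2 ∧
        {x : Martindale.Qs R | x ∈ Martindale.centralClosure R ∧
            ∀ a ∈ prodSubgroups m K, Martindale.Qs.ofRing R a * x = x * Martindale.Qs.ofRing R a} =
          (Martindale.extend (K 0 : Set R) : Set (Martindale.Qs R))) :=
  (mainTheorem10_general m K hK hKZ).imp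
    Martindale.centralizer_eq_center_of_centralizer_image_eq
    (And.imp_right (And.imp_right
      Martindale.centralClosure_inter_centralizer_eq_of_centralizer_image_eq))
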